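/- Let $E$ be a real or complex Banach space and let $D$, with domain $\mathcal{D}(D)$, be the infinitesimal generator of a strongly continuous one-parameter group $e^{tD}$, $t\in\mathbb{R}$, of linear isometries of $E$. For $k\ge 0$ let $\mathcal{D}^k$ be the natural domain of the power $D^k$ and put $\mathcal{D}^\infty=\bigcap_{k}\mathcal{D}^k$. For $\sigma\ge 0$ let $$\mathbf{B}_\sigma(D)=\{f\in\mathcal{D}^\infty:\ \|D^kf\|\le\sigma^k\|f\|\ \text{ for all } k\in\mathbb{N}\}.$$ For $f\in E$ let $\sigma_f$ be the smallest real number $\sigma\ge 0$ with $f\in\mathbf{B}_\sigma(D)$, if there is one, and $\sigma_f=\infty$ otherwise. **Theorem.** Let $f\in E$. 1. If $f\in\mathbf{B}_\sigma(D)$ for some $0<\sigma<\infty$, then the limit $d_f=\lim_{k\to\infty}\|D^kf\|^{1/k}$ exists, is finite, and $d_f=\sigma_f$. 2. Conversely, if $f\in\mathcal{D}^\infty$ and the limit $d_f=\lim_{k\to\infty}\|D^kf\|^{1/k}$ exists and is finite, then $f\in\mathbf{B}_{d_f}(D)$ and $d_f=\sigma_f$. -/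

import Mathlib

open Filter Topology

noncomputable section

namespace BernsteinVectors

variable {𝕜 E : Type*} [RCLike 𝕜] [NormedAddCommGroup E] [NormedSpace 𝕜 E]

variable (𝕜 E) in
/-- A strongly continuous one-parameter group of linear isometries `t ↦ U t`, `t ∈ ℝ`, of `E`.
Each `U t` is surjective because `U t` and `U (-t)` are inverse to each other. -/
structure IsometryGroup where
  /-- The operator at time `t`. -/
  toFun : ℝ → E →ₗᵢ[𝕜] E
  map_zero' : ∀ f : E, toFun 0 f = f
  map_add' : ∀ (s t : ℝ) (f : E), toFun (s + t) f = toFun s (toFun t f)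
  continuous' : ∀ f : E, Continuous fun t : ℝ => toFun t f

/-- The difference quotient `(U t f - f) / t`, as a linear map in `f`. -/
def IsometryGroup.quotient (U : IsometryGroup 𝕜 E) (t : ℝ) : E →ₗ[𝕜] E :=
  ((t : 𝕜)⁻¹) • ((U.toFun t).toLinearMap - LinearMap.id)

theorem IsometryGroup.quotient_apply (U : IsometryGroup 𝕜 E) (t : ℝ) (f : E) :
    U.quotient t f = ((t : 𝕜)⁻¹) • (U.toFun t f - f) := rfl

/-- The domain of the generator: all `f` for which `(U t f - f) / t` converges in norm
as `t → 0`, `t ≠ 0`. -/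
def IsometryGroup.generatorDomain (U : IsometryGroup 𝕜 E) : Submodule 𝕜 E where
  carrier := {f | ∃ g : E, Tendsto (fun t : ℝ => U.quotient t f) (𝓝[≠] 0) (𝓝 g)}
  zero_mem' := ⟨0, by simp⟩
  add_mem' := by
    rintro a b ⟨x, hx⟩ ⟨y, hy⟩
    exact ⟨x + y, by simpa using hx.add hy⟩
  smul_mem' := by
    rintro c a ⟨x, hx⟩
    exact ⟨c • x, by simpa using hx.const_smul c⟩

/-- The infinitesimal generator `D` of the group `U = e^{tD}`:
`D f = lim_{t → 0} (U t f - f) / t`, on the domain where this limit exists. -/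
def IsometryGroup.generator (U : IsometryGroup 𝕜 E) : E →ₗ.[𝕜] E where
  domain := U.generatorDomain
  toFun :=
    { toFun := fun f => Classical.choose f.2
      map_add' := fun a b => by
        refine tendsto_nhds_unique (Classical.choose_spec (a + b).2) ?_
        simpa using (Classical.choose_spec a.2).add (Classical.choose_spec b.2)
      map_smul' := fun c a => by
        refine tendsto_nhds_unique (Classical.choose_spec (c • a).2) ?_
        simpa using (Classical.choose_spec a.2).const_smul c }

theorem IsometryGroup.mem_generator_domain (U : IsometryGroup 𝕜 E) (f : E) :
    f ∈ U.generator.domain ↔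
      ∃ g : E, Tendsto (fun t : ℝ => ((t : 𝕜)⁻¹) • (U.toFun t f - f)) (𝓝[≠] 0) (𝓝 g) :=
  Iff.rfl

theorem IsometryGroup.tendsto_generator (U : IsometryGroup 𝕜 E) (f : U.generator.domain) :
    Tendsto (fun t : ℝ => ((t : 𝕜)⁻¹) • (U.toFun t (f : E) - (f : E))) (𝓝[≠] 0)
      (𝓝 (U.generator f)) :=
  Classical.choose_spec f.2

/-- The composition `A B` of unbounded operators, on its natural domain
`{f ∈ dom B | B f ∈ dom A}`. -/
def compose (A B : E →ₗ.[𝕜] E) : E →ₗ.[𝕜] E where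
  domain := (A.domain.comap B.toFun).map B.domain.subtype
  toFun :=
    { toFun := fun f => A ⟨B ⟨f, (Submodule.map_subtype_le _ _) f.2⟩, by
        obtain ⟨x, hx, hxf⟩ := f.2
        have h : (⟨f, (Submodule.map_subtype_le _ _) f.2⟩ : B.domain) = x := Subtype.ext hxf.symm
        rw [h]
        exact hx⟩
      map_add' := fun a b => by
        rw [← A.map_add]
        congr 1
        apply Subtype.ext
        exact B.map_add ⟨a, (Submodule.map_subtype_le _ _) a.2⟩
          ⟨b, (Submodule.map_subtype_le _ _) b.2⟩
      map_smul' := fun c a => by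
        rw [RingHom.id_apply, ← A.map_smul]
        congr 1
        apply Subtype.ext
        exact B.map_smul c ⟨a, (Submodule.map_subtype_le _ _) a.2⟩ }

theorem mem_compose_domain (A B : E →ₗ.[𝕜] E) (f : E) :
    f ∈ (compose A B).domain ↔ ∃ h : f ∈ B.domain, B ⟨f, h⟩ ∈ A.domain := by
  constructor
  · rintro ⟨x, hx, rfl⟩
    exact ⟨x.2, hx⟩
  · rintro ⟨h, hA⟩
    exact ⟨⟨f, h⟩, hA, rfl⟩

theorem compose_apply (A B : E →ₗ.[𝕜] E) (f : E) (h : f ∈ B.domain) (hA : B ⟨f, h⟩ ∈ A.domain)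
    (hf : f ∈ (compose A B).domain) : compose A B ⟨f, hf⟩ = A ⟨B ⟨f, h⟩, hA⟩ := rfl

/-- The power `D ^ k` of an unbounded operator on its natural domain; `D ^ 0` is the identity
of `E` and `D ^ (k + 1) = D (D ^ k)`. -/
def power (D : E →ₗ.[𝕜] E) : ℕ → (E →ₗ.[𝕜] E)
  | 0 => LinearMap.toPMap LinearMap.id ⊤
  | k + 1 => compose D (power D k)

/-- The space `𝒟^∞`, the intersection of the domains of all powers of `D`. -/
def smoothVectors (D : E →ₗ.[𝕜] E) : Submodule 𝕜 E :=
  ⨅ k : ℕ, (power D k).domain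

theorem mem_power_domain (D : E →ₗ.[𝕜] E) {f : E} (hf : f ∈ smoothVectors D) (k : ℕ) :
    f ∈ (power D k).domain :=
  (Submodule.mem_iInf _).1 hf k

/-- The vector `D ^ k f` for `f ∈ 𝒟^∞`. -/
def powerApply (D : E →ₗ.[𝕜] E) (k : ℕ) (f : smoothVectors D) : E :=
  power D k ⟨f, mem_power_domain D f.2 k⟩

/-- The Bernstein space `B_σ(D)` (meant for `σ ≥ 0`): all `f ∈ 𝒟^∞` such that
`‖D ^ k f‖ ≤ σ ^ k ‖f‖` for all `k`. -/
def bernsteinSpace (D : E →ₗ.[𝕜] E) (σ : ℝ) : Set E :=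
  {f | ∃ hf : f ∈ smoothVectors D, ∀ k : ℕ, ‖powerApply D k ⟨f, hf⟩‖ ≤ σ ^ k * ‖f‖}

open Classical in
/-- The number `σ_f`: the smallest real `σ ≥ 0` with `‖D ^ k f‖ ≤ σ ^ k ‖f‖` for all `k`
if there is one, and `∞` otherwise. -/
def spectralBound (D : E →ₗ.[𝕜] E) (f : E) : EReal :=
  if h : ∃ s : ℝ, IsLeast {σ : ℝ | 0 ≤ σ ∧ f ∈ bernsteinSpace D σ} s then
    ((Classical.choose h : ℝ) : EReal)
  else ⊤

theorem spectralBound_eq_coe_iff (D : E →ₗ.[𝕜] E) (f : E) (s : ℝ) :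
    spectralBound D f = (s : EReal) ↔
      IsLeast {σ : ℝ | 0 ≤ σ ∧ f ∈ bernsteinSpace D σ} s := by
  unfold spectralBound
  split_ifs with h
  · rw [EReal.coe_eq_coe_iff]
    constructor
    · rintro rfl
      exact Classical.choose_spec h
    · exact fun hs => (Classical.choose_spec h).unique hs
  · exact ⟨fun h' => absurd h'.symm (EReal.coe_ne_top s), fun hs => absurd ⟨s, hs⟩ h⟩

end BernsteinVectors

end

/-!
Write `a k = ‖D ^ k f‖`. A functional `g` that norms `D ^ m f` turns the orbits into the real
functions `u k t = Re g (U t (D ^ k f))`, which satisfy `(u k)' = u (k + 1)` and `|u k| ≤ a k` because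
the group is isometric (`BernsteinVectors.exists_norming_chain`). Two facts about such functions give
two properties of the sequence `a`, and these decide the behaviour of `a k ^ (1 / k)`.

The first is Bernstein's inequality, `deriv_le_of_chain`: if `a k ≤ C * ρ ^ k` for all `k`, then
`a k ≤ ρ ^ k * a 0` for all `k`. Here `u 0` extends to an entire function `F` of exponential type `ρ`.
If `|F| ≤ M` on the real line, two applications of the Phragmén–Lindelöf principle show that
`Im F (i y) ≤ M sinh (ρ y)` for `y ≥ 0` (`im_le_mul_sinh_of_lt`), and the derivative at `y = 0` is
`F' 0 ≤ ρ M`. Consequently, if the roots converge to `d`, then every `ρ > d` is admissible in the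
definition of the Bernstein space, hence so is `d`; and nothing smaller is.

The second, `abs_add_le_of_chain`, is needed for the existence of the limit: if `a n ≤ R ^ n` for
infinitely many `n`, then `a (j + 2) ≤ R ^ 2 * a j + 2 * (a 0 + 1) * R ^ (j + 2)` for all `j`, so `a j`
is at most of order `j * R ^ j`. Thus the lower limit of the roots cannot lie below the upper one. The
reason is that the truncated resolvent series `∑ k < n, D ^ k f / z ^ (k + 1)` is bounded by a multiple
of `1 / |Re z|` on the circle `|z| = R`, uniformly in `n`; multiplying by `z ^ 2 + R ^ 2`, which is
`2 R |Re z|` in absolute value on this circle, removes the singularity on the imaginary axis, and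
Cauchy's estimate bounds the coefficients.
-/

/-! ### Bernstein's inequality for entire functions -/

/-- Exponential growth, in the form that the Phragmén–Lindelöf principle in the right half-plane
takes as its hypothesis. -/
theorem exists_isBigO_exp_of_norm_le {f : ℂ → ℂ} {A B : ℝ}
    (h : ∀ z : ℂ, 0 < z.re → ‖f z‖ ≤ A * Real.exp (B * ‖z‖)) :
    ∃ c < (2 : ℝ), ∃ B' : ℝ, f =O[Bornology.cobounded ℂ ⊓ 𝓟 {z | 0 < z.re}]
      fun z => Real.exp (B' * ‖z‖ ^ c) := by
  refine ⟨1, by norm_num, B, Asymptotics.IsBigO.of_bound A ?_⟩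
  filter_upwards [mem_inf_of_right (mem_principal_self _)] with z hz
  simpa [abs_of_pos (Real.exp_pos _)] using h z hz

/-- A function of exponential type `ρ` bounded by `M` on the real line is bounded by `M * exp (ρ * y)`
in the upper half-plane, which is parametrized here as `ζ ↦ I * ζ`, `0 ≤ ζ.re`. -/
theorem norm_mul_exp_le_of_real_bound {F : ℂ → ℂ} (hF : Differentiable ℂ F) {ρ C M : ℝ}
    (hgrowth : ∀ z, ‖F z‖ ≤ C * Real.exp (ρ * ‖z‖)) (hM : ∀ x : ℝ, ‖F x‖ ≤ M)
    {ζ : ℂ} (hζ : 0 ≤ ζ.re) : ‖F (Complex.I * ζ) * Complex.exp (-(ρ * ζ))‖ ≤ M := by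
  have hd : Differentiable ℂ fun ζ : ℂ => F (Complex.I * ζ) * Complex.exp (-(ρ * ζ)) :=
    (hF.comp (by fun_prop)).mul (by fun_prop)
  have hC : 0 ≤ C := by simpa using (norm_nonneg _).trans (hgrowth 0)
  have hb : ∀ z : ℂ, ‖F (Complex.I * z) * Complex.exp (-(ρ * z))‖ ≤
      C * Real.exp (ρ * ‖z‖ - ρ * z.re) := by
    intro z
    rw [norm_mul, Complex.norm_exp, sub_eq_add_neg, Real.exp_add, ← mul_assoc]
    have := hgrowth (Complex.I * z)
    simp only [norm_mul, Complex.norm_I, one_mul] at this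
    simpa using mul_le_mul_of_nonneg_right this (Real.exp_pos _).le
  refine PhragmenLindelof.right_half_plane_of_bounded_on_real
    (f := fun ζ : ℂ => F (Complex.I * ζ) * Complex.exp (-(ρ * ζ))) hd.diffContOnCl
    (exists_isBigO_exp_of_norm_le (A := C) (B := |ρ| + |ρ|) ?_) ?_ ?_ hζ
  · intro z _
    refine (hb z).trans (mul_le_mul_of_nonneg_left (Real.exp_le_exp.2 ?_) hC)
    have h1 : ρ * ‖z‖ ≤ |ρ| * ‖z‖ := mul_le_mul_of_nonneg_right (le_abs_self ρ) (norm_nonneg z)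
    have h2 : -(ρ * z.re) ≤ |ρ| * ‖z‖ := by
      refine (neg_le_abs _).trans ?_
      rw [abs_mul]
      exact mul_le_mul_of_nonneg_left (Complex.abs_re_le_norm z) (abs_nonneg ρ)
    linarith
  · refine isBoundedUnder_of_eventually_le (a := C) ?_
    filter_upwards [eventually_ge_atTop 0] with x hx
    simpa [abs_of_nonneg hx] using hb x
  · intro x
    have h1 : Complex.I * (x * Complex.I) = ((-x : ℝ) : ℂ) := by
      push_cast; linear_combination (x : ℂ) * Complex.I_mul_I
    simpa [h1, Complex.norm_exp] using hM (-x)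

/-- The core of Bernstein's inequality: on the imaginary axis `r * sin (ρ * z)` has a larger imaginary
part than `F`. With `P ζ = F (I * ζ) * exp (-ρ * ζ)`, which is bounded by `M < r` in the right
half-plane, the quotient `Θ = (-r * I * exp (-2 * ρ * ζ) - P) / (r * I - P)` is bounded there and
unimodular on the boundary, hence bounded by `1`; expanding `|Θ y| ≤ 1` gives the claim. -/
theorem im_le_mul_sinh_of_lt {F : ℂ → ℂ} (hF : Differentiable ℂ F) {ρ C M r : ℝ} (hρ : 0 ≤ ρ)
    (hgrowth : ∀ z, ‖F z‖ ≤ C * Real.exp (ρ * ‖z‖)) (hreal : ∀ x : ℝ, (F x).im = 0)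
    (hM : ∀ x : ℝ, ‖F x‖ ≤ M) (hr : M < r) {y : ℝ} (hy : 0 ≤ y) :
    (F (Complex.I * y)).im ≤ r * Real.sinh (ρ * y) := by
  have hM0 : 0 ≤ M := (norm_nonneg _).trans (hM 0)
  have hr0 : 0 < r := hM0.trans_lt hr
  set P : ℂ → ℂ := fun ζ => F (Complex.I * ζ) * Complex.exp (-(ρ * ζ)) with hPdef
  have hP : ∀ ζ : ℂ, 0 ≤ ζ.re → ‖P ζ‖ ≤ M := fun ζ hζ =>
    norm_mul_exp_le_of_real_bound hF hgrowth hM hζ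
  have hPd : Differentiable ℂ P := (hF.comp (by fun_prop)).mul (by fun_prop)
  have hden : ∀ ζ : ℂ, 0 ≤ ζ.re → r - M ≤ ‖r * Complex.I - P ζ‖ := by
    intro ζ hζ
    have h1 := norm_sub_norm_le ((r : ℂ) * Complex.I) (P ζ)
    have h2 : ‖(r : ℂ) * Complex.I‖ = r := by simp [abs_of_pos hr0]
    linarith [hP ζ hζ]
  have hden0 : ∀ ζ : ℂ, 0 ≤ ζ.re → r * Complex.I - P ζ ≠ 0 := by
    intro ζ hζ h
    have := hden ζ hζ
    rw [h, norm_zero] at this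
    linarith
  set Θ : ℂ → ℂ := fun ζ =>
    (-(r * Complex.I * Complex.exp (-(2 * ρ * ζ))) - P ζ) / (r * Complex.I - P ζ) with hΘ
  have hΘb : ∀ ζ : ℂ, 0 ≤ ζ.re → ‖Θ ζ‖ ≤ (r + M) / (r - M) := by
    intro ζ hζ
    rw [hΘ, norm_div]
    have he : ‖Complex.exp (-(2 * ρ * ζ))‖ ≤ 1 := by
      rw [Complex.norm_exp, Real.exp_le_one_iff]
      have : 0 ≤ ρ * ζ.re := mul_nonneg hρ hζ
      simp [mul_assoc, this]
    have hnum : ‖-(r * Complex.I * Complex.exp (-(2 * ρ * ζ))) - P ζ‖ ≤ r + M := by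
      refine (norm_sub_le _ _).trans (add_le_add ?_ (hP ζ hζ))
      rw [norm_neg, norm_mul]
      have h2 : ‖(r : ℂ) * Complex.I‖ = r := by simp [abs_of_pos hr0]
      rw [h2]
      exact mul_le_of_le_one_right hr0.le he
    exact div_le_div₀ (by linarith) hnum (by linarith) (hden ζ hζ)
  have hcl : closure {z : ℂ | 0 < z.re} ⊆ {z : ℂ | 0 ≤ z.re} :=
    closure_minimal (fun z (hz : 0 < z.re) => hz.le) (isClosed_le continuous_const Complex.continuous_re)
  have hΘd : DiffContOnCl ℂ Θ {z | 0 < z.re} := by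
    refine DifferentiableOn.diffContOnCl fun z hz => ?_
    have hnum : Differentiable ℂ fun ζ : ℂ =>
        -(r * Complex.I * Complex.exp (-(2 * ρ * ζ))) - P ζ := by fun_prop
    have hd : Differentiable ℂ fun ζ : ℂ => r * Complex.I - P ζ := by fun_prop
    exact ((hnum z).div (hd z) (hden0 z (hcl hz))).differentiableWithinAt
  have hΘ1 : ‖Θ (y : ℂ)‖ ≤ 1 := by
    refine PhragmenLindelof.right_half_plane_of_bounded_on_real hΘd
      (exists_isBigO_exp_of_norm_le (A := (r + M) / (r - M)) (B := 0) ?_) ?_ ?_ (by simpa using hy)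
    · intro z hz
      simpa using hΘb z (le_of_lt hz)
    · refine isBoundedUnder_of_eventually_le (a := (r + M) / (r - M)) ?_
      filter_upwards [eventually_ge_atTop 0] with x hx
      exact hΘb x (by simpa using hx)
    · intro x
      -- On the boundary line the numerator is, up to a unimodular factor, the conjugate of the
      -- denominator, because `F` is real there.
      rw [hΘ, norm_div]
      refine div_le_one_of_le₀ (le_of_eq ?_) (norm_nonneg _)
      have h1 : Complex.I * (x * Complex.I) = ((-x : ℝ) : ℂ) := by
        push_cast; linear_combination (x : ℂ) * Complex.I_mul_I
      have hconj : (starRingEnd ℂ) (F ((-x : ℝ) : ℂ)) = F ((-x : ℝ) : ℂ) :=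
        Complex.conj_eq_iff_im.2 (hreal _)
      set e : ℂ := Complex.exp (-(ρ * (x * Complex.I))) with he
      have hene : e ≠ 0 := Complex.exp_ne_zero _
      have hconje : (starRingEnd ℂ) e = e⁻¹ := by
        rw [he, ← Complex.exp_conj, ← Complex.exp_neg]
        simp
      have he2 : Complex.exp (-(2 * ρ * (x * Complex.I))) = e * e := by
        rw [he, ← Complex.exp_add]; ring_nf
      have hnorm : ‖e * e‖ = 1 := by
        rw [← he2, Complex.norm_exp]; simp
      have hkey : -(r * Complex.I * Complex.exp (-(2 * ρ * (x * Complex.I)))) - P (x * Complex.I) =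
          (e * e) * (starRingEnd ℂ) (r * Complex.I - P (x * Complex.I)) := by
        simp only [hPdef, h1, he2, map_sub, map_mul, hconj, ← he, hconje, Complex.conj_I,
          Complex.conj_ofReal]
        field_simp
      rw [hkey, norm_mul, hnorm, one_mul, Complex.norm_conj]
  have hle : ‖-(r * Complex.I * Complex.exp (-(2 * ρ * (y : ℂ)))) - P y‖ ≤
      ‖r * Complex.I - P y‖ := by
    rw [hΘ, norm_div] at hΘ1
    exact (div_le_one (norm_pos_iff.2 (hden0 y (by simpa using hy)))).1 hΘ1
  set b : ℝ := Real.exp (-(ρ * y)) with hb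
  have hb0 : 0 < b := Real.exp_pos _
  have he1 : Complex.exp (-(ρ * (y : ℂ))) = (b : ℂ) := by rw [hb]; push_cast; rfl
  have he2 : Complex.exp (-(2 * ρ * (y : ℂ))) = ((b * b : ℝ) : ℂ) := by
    rw [hb, ← Real.exp_add]; push_cast; ring_nf
  have hsq := pow_le_pow_left₀ (norm_nonneg _) hle 2
  rw [← Complex.normSq_eq_norm_sq, ← Complex.normSq_eq_norm_sq, he2] at hsq
  simp only [hPdef, he1, Complex.normSq_apply] at hsq
  simp at hsq
  set v := (F (Complex.I * y)).im
  have h3 : 2 * (v * b) * (1 + b * b) ≤ (r * (1 - b * b)) * (1 + b * b) := by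
    have : r * (2 * (v * b) * (1 + b * b)) ≤ r * ((r * (1 - b * b)) * (1 + b * b)) := by
      nlinarith [hsq]
    exact le_of_mul_le_mul_left this hr0
  have h4 : 2 * (v * b) ≤ r * (1 - b * b) := le_of_mul_le_mul_right h3 (by positivity)
  have hbe : b * Real.exp (ρ * y) = 1 := by rw [hb, ← Real.exp_add]; simp
  rw [Real.sinh_eq]
  have h5 : (2 * v) * b ≤ (r * (Real.exp (ρ * y) - b)) * b := by nlinarith
  have h6 := le_of_mul_le_mul_right h5 hb0
  rw [← hb]
  linarith

/-- **Bernstein's inequality** at the origin, for an entire function of exponential type `ρ` that is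
real on the real line. It is the derivative at `y = 0` of `Im F (I * y) ≤ M * sinh (ρ * y)`, an
equality at `y = 0`. -/
theorem deriv_zero_le_mul_of_real_bound {F : ℂ → ℂ} (hF : Differentiable ℂ F) {ρ C M c : ℝ} (hρ : 0 ≤ ρ)
    (hgrowth : ∀ z, ‖F z‖ ≤ C * Real.exp (ρ * ‖z‖)) (hreal : ∀ x : ℝ, (F x).im = 0)
    (hM : ∀ x : ℝ, ‖F x‖ ≤ M) (hc : HasDerivAt F c 0) : c ≤ ρ * M := by
  have hle : ∀ y : ℝ, 0 ≤ y → (F (Complex.I * y)).im ≤ M * Real.sinh (ρ * y) := by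
    intro y hy
    have ht : Tendsto (fun r : ℝ => r * Real.sinh (ρ * y)) (𝓝[>] M)
        (𝓝 (M * Real.sinh (ρ * y))) :=
      ((continuous_id.mul continuous_const).tendsto M).mono_left nhdsWithin_le_nhds
    refine ge_of_tendsto ht ?_
    filter_upwards [self_mem_nhdsWithin] with r hr
    exact im_le_mul_sinh_of_lt hF hρ hgrowth hreal hM hr hy
  have hd1 : HasDerivAt (fun y : ℝ => (F (Complex.I * y)).im) c 0 := by
    have h1 : HasDerivAt (fun y : ℂ => Complex.I * y) Complex.I ((0 : ℝ) : ℂ) := by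
      simpa using (hasDerivAt_id ((0 : ℝ) : ℂ)).const_mul Complex.I
    have h2 : HasDerivAt F c (Complex.I * ((0 : ℝ) : ℂ)) := by simpa using hc
    have h3 := (h2.comp _ h1).comp_ofReal
    have h4 := Complex.imCLM.hasFDerivAt.comp_hasDerivAt (0 : ℝ) h3
    simpa using! h4
  have hd2 : HasDerivAt (fun y : ℝ => M * Real.sinh (ρ * y)) (ρ * M) 0 := by
    have h1 : HasDerivAt (fun y : ℝ => ρ * y) ρ 0 := by
      simpa using (hasDerivAt_id (0 : ℝ)).const_mul ρ
    simpa [mul_comm] using (h1.sinh.const_mul M)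
  have hd := hd2.sub hd1
  have hF0 : (F 0).im = 0 := by simpa using hreal 0
  have hs := hd.tendsto_slope_zero_right
  have h0 := ge_of_tendsto hs (b := 0) ?_
  · linarith
  filter_upwards [self_mem_nhdsWithin] with y hy
  have hy0 : 0 ≤ y := le_of_lt hy
  have h1 := hle y hy0
  simp only [Pi.sub_apply, zero_add, smul_eq_mul, Complex.ofReal_zero, mul_zero, hF0,
    Real.sinh_zero, sub_zero]
  exact mul_nonneg (inv_nonneg.2 hy0) (sub_nonneg.2 h1)

/-! ### Chains of bounded derivatives on the real line -/

open Finset in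
/-- Taylor's formula with the factorial in the error bound, for a sequence of functions each of
which is the derivative of the one before. -/
theorem abs_sub_taylor_le (n : ℕ) : ∀ {u : ℕ → ℝ → ℝ} {a : ℕ → ℝ},
    (∀ k t, HasDerivAt (u k) (u (k + 1) t) t) → (∀ k t, |u k t| ≤ a k) → ∀ {x : ℝ}, 0 ≤ x →
    |u 0 x - ∑ k ∈ range n, u k 0 * (x ^ k / (k.factorial : ℝ))| ≤
      a n * (x ^ n / (n.factorial : ℝ)) := by
  have hpow : ∀ (k : ℕ) (x : ℝ), HasDerivAt (fun t : ℝ => t ^ (k + 1) / ((k + 1).factorial : ℝ))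
      (x ^ k / (k.factorial : ℝ)) x := by
    intro k x
    have h := (hasDerivAt_pow (k + 1) x).div_const ((k + 1).factorial : ℝ)
    refine h.congr_deriv ?_
    rw [Nat.factorial_succ, Nat.add_sub_cancel]
    push_cast
    field_simp
  induction n with
  | zero => intro u a hu hb x hx; simpa using hb 0 x
  | succ n ih =>
    intro u a hu hb x hx
    have hd : ∀ t : ℝ, HasDerivAt
        (fun t => u 0 t - ∑ k ∈ range (n + 1), u k 0 * (t ^ k / (k.factorial : ℝ)))
        (u 1 t - ∑ k ∈ range n, u (k + 1) 0 * (t ^ k / (k.factorial : ℝ))) t := by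
      intro t
      simp only [sum_range_succ' _ n, pow_zero]
      refine (hu 0 t).sub ?_
      refine HasDerivAt.add_const _ ?_
      exact HasDerivAt.fun_sum fun k _ => (hpow k t).const_mul _
    refine image_norm_le_of_norm_deriv_right_le_deriv_boundary (a := 0) (b := x)
      (fun t _ => (hd t).continuousAt.continuousWithinAt) (fun t _ => (hd t).hasDerivWithinAt)
      (B := fun t => a (n + 1) * (t ^ (n + 1) / ((n + 1).factorial : ℝ))) ?_
      (fun t => (hpow n t).const_mul _) (fun t ht => ?_) ⟨hx, le_rfl⟩
    · simp [sum_range_succ']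
    · exact ih (u := fun k => u (k + 1)) (a := fun k => a (k + 1)) (fun k => hu (k + 1))
        (fun k => hb (k + 1)) ht.1

theorem hasSum_taylor_of_nonneg {u : ℕ → ℝ → ℝ} {C ρ : ℝ}
    (hu : ∀ k t, HasDerivAt (u k) (u (k + 1) t) t) (hb : ∀ k t, |u k t| ≤ C * ρ ^ k)
    (hs : ∀ x : ℝ, Summable fun k : ℕ => u k 0 * (x ^ k / (k.factorial : ℝ)))
    {x : ℝ} (hx : 0 ≤ x) : HasSum (fun k : ℕ => u k 0 * (x ^ k / (k.factorial : ℝ))) (u 0 x) := by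
  refine ((hs x).hasSum_iff_tendsto_nat).2 ?_
  rw [tendsto_iff_norm_sub_tendsto_zero]
  have h0 : Tendsto (fun n : ℕ => C * ((ρ * x) ^ n / (n.factorial : ℝ))) atTop (𝓝 0) := by
    simpa using (FloorSemiring.tendsto_pow_div_factorial_atTop (ρ * x)).const_mul C
  refine squeeze_zero (fun n => norm_nonneg _) (fun n => ?_) h0
  rw [norm_sub_rev]
  refine (abs_sub_taylor_le n hu hb hx).trans (le_of_eq ?_)
  rw [mul_pow]; ring

theorem summable_taylor {c : ℕ → ℝ} {C ρ : ℝ} (hc : ∀ k, |c k| ≤ C * ρ ^ k) (x : ℝ) :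
    Summable fun k : ℕ => c k * (x ^ k / (k.factorial : ℝ)) := by
  refine Summable.of_norm_bounded (g := fun k => C * ((ρ * |x|) ^ k / (k.factorial : ℝ)))
    ((Real.summable_pow_div_factorial _).mul_left C) fun k => ?_
  rw [norm_mul, norm_div, norm_pow, Real.norm_eq_abs, Real.norm_eq_abs, Real.norm_natCast, mul_pow,
    ← mul_div_assoc, ← mul_div_assoc, ← mul_assoc]
  gcongr
  exact hc k

theorem hasSum_taylor {u : ℕ → ℝ → ℝ} {C ρ : ℝ}
    (hu : ∀ k t, HasDerivAt (u k) (u (k + 1) t) t) (hb : ∀ k t, |u k t| ≤ C * ρ ^ k) (x : ℝ) :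
    HasSum (fun k : ℕ => u k 0 * (x ^ k / (k.factorial : ℝ))) (u 0 x) := by
  rcases le_total 0 x with hx | hx
  · exact hasSum_taylor_of_nonneg hu hb (summable_taylor fun k => hb k 0) hx
  · set w : ℕ → ℝ → ℝ := fun k t => (-1) ^ k * u k (-t) with hw
    have hwb : ∀ k t, |w k t| ≤ C * ρ ^ k := by
      intro k t
      simpa [hw, abs_mul] using hb k (-t)
    have hwd : ∀ k t, HasDerivAt (w k) (w (k + 1) t) t := by
      intro k t
      have h1 := ((hu k (-t)).comp t (hasDerivAt_neg t)).const_mul ((-1 : ℝ) ^ k)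
      convert! h1 using 1
      simp [hw, pow_succ]
    have h := hasSum_taylor_of_nonneg hwd hwb (summable_taylor fun k => hwb k 0)
      (neg_nonneg.2 hx)
    convert! h using 1
    · funext k
      have : (-1 : ℝ) ^ k * (-1) ^ k = 1 := by rw [← mul_pow]; simp
      simp only [hw, neg_zero, neg_pow x]
      linear_combination -(u k 0 * (x ^ k / (k.factorial : ℝ))) * this
    · simp [hw]

/-- Bernstein's inequality on the real line: only the supremum `M` of `u 0` enters the bound, not the
constant `C`. The Taylor series at `0` extends `u 0` to an entire function of exponential type `ρ`. -/
theorem deriv_le_of_chain {u : ℕ → ℝ → ℝ} {C ρ M : ℝ} (hρ : 0 ≤ ρ)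
    (hu : ∀ k t, HasDerivAt (u k) (u (k + 1) t) t) (hb : ∀ k t, |u k t| ≤ C * ρ ^ k)
    (hM : ∀ t, |u 0 t| ≤ M) : u 1 0 ≤ ρ * M := by
  set G : ℕ → ℂ → ℂ := fun k z => (u k 0 : ℂ) * (z ^ k / (k.factorial : ℂ)) with hG
  have hGle : ∀ k z, ‖G k z‖ ≤ C * ((ρ * ‖z‖) ^ k / (k.factorial : ℝ)) := by
    intro k z
    have h1 := hb k 0
    simp only [hG, norm_mul, norm_div, norm_pow, Complex.norm_real, Real.norm_eq_abs,
      Complex.norm_natCast]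
    rw [mul_pow, ← mul_div_assoc, ← mul_div_assoc, ← mul_assoc]
    gcongr
  have hGd : ∀ k, Differentiable ℂ (G k) := fun k =>
    ((differentiable_pow k).div_const _).const_mul _
  have hC : 0 ≤ C := by simpa using (abs_nonneg _).trans (hb 0 0)
  have hsum : ∀ T : ℝ, Summable fun k : ℕ => C * ((ρ * T) ^ k / (k.factorial : ℝ)) := fun T =>
    (Real.summable_pow_div_factorial _).mul_left C
  have hball : ∀ (T : ℝ) (k : ℕ) (w : ℂ), w ∈ Metric.ball (0 : ℂ) T →
      ‖G k w‖ ≤ C * ((ρ * T) ^ k / (k.factorial : ℝ)) := by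
    intro T k w hw
    refine (hGle k w).trans ?_
    have : ‖w‖ ≤ T := by simpa using (mem_ball_zero_iff.1 hw).le
    gcongr
  set F : ℂ → ℂ := fun z => ∑' k, G k z with hF
  have hFd : Differentiable ℂ F := by
    intro z
    have hz : z ∈ Metric.ball (0 : ℂ) (‖z‖ + 1) := by simp
    exact (Complex.differentiableOn_tsum_of_summable_norm (hsum (‖z‖ + 1))
      (fun k => (hGd k).differentiableOn) Metric.isOpen_ball
      (hball _)).differentiableAt (Metric.isOpen_ball.mem_nhds hz)
  have hFreal : ∀ x : ℝ, F x = (u 0 x : ℂ) := by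
    intro x
    have h := Complex.hasSum_ofReal.2 (hasSum_taylor hu hb x)
    rw [← h.tsum_eq, hF]
    simp [hG]
  have hFgrowth : ∀ z, ‖F z‖ ≤ C * Real.exp (ρ * ‖z‖) := by
    intro z
    have h : HasSum (fun k : ℕ => C * ((ρ * ‖z‖) ^ k / (k.factorial : ℝ)))
        (C * Real.exp (ρ * ‖z‖)) := by
      rw [Real.exp_eq_exp_ℝ]
      exact (NormedSpace.expSeries_div_hasSum_exp (ρ * ‖z‖)).mul_left C
    exact tsum_of_norm_bounded h fun k => hGle k z
  have hFderiv : HasDerivAt F (u 1 0 : ℝ) 0 := by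
    have h := Complex.hasSum_deriv_of_summable_norm (hsum 1)
      (fun k => (hGd k).differentiableOn) Metric.isOpen_ball (hball 1)
      (z := 0) (by simp)
    have h1 : HasSum (fun k => deriv (G k) 0) ((u 1 0 : ℝ) : ℂ) := by
      have : ((u 1 0 : ℝ) : ℂ) = deriv (G 1) 0 := by simp [hG]
      rw [this]
      refine hasSum_single 1 fun k hk => ?_
      rcases Nat.eq_zero_or_pos k with rfl | hk0
      · simp [hG]
      · have : k - 1 ≠ 0 := by omega
        simp [hG, this]
    rw [← h.unique h1]
    exact (hFd 0).hasDerivAt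
  exact deriv_zero_le_mul_of_real_bound hFd hρ hFgrowth (fun x => by rw [hFreal]; simp)
    (fun x => by rw [hFreal]; simpa using hM x) hFderiv

/-! ### Recovering intermediate derivatives -/

/-- The resolvent bound `‖(μ - d/dt)⁻¹‖ ≤ 1 / μ.re` on bounded functions, evaluated at `0`: integrate
`exp (-μ * t) * (μ * g t - g' t)` over `[0, ∞)`. -/
theorem norm_le_div_of_re_pos {g g' : ℝ → ℂ} {μ : ℂ} {B K : ℝ} (hμ : 0 < μ.re)
    (hg : ∀ t, HasDerivAt g (g' t) t) (hB : ∀ t, ‖g t‖ ≤ B) (hK : ∀ t, ‖μ * g t - g' t‖ ≤ K) :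
    ‖g 0‖ ≤ K / μ.re := by
  set α := μ.re with hα
  have hderiv : ∀ t : ℝ, HasDerivAt (fun t : ℝ => Complex.exp (-(μ * t)) * g t - g 0)
      (-(Complex.exp (-(μ * t)) * (μ * g t - g' t))) t := by
    intro t
    have h1 : HasDerivAt (fun t : ℝ => Complex.exp (-(μ * t))) (Complex.exp (-(μ * t)) * -μ) t := by
      have h2 : HasDerivAt (fun t : ℂ => -(μ * t)) (-μ) (t : ℂ) := by
        simpa using! ((hasDerivAt_id (t : ℂ)).const_mul μ).neg
      exact h2.cexp.comp_ofReal
    refine ((h1.mul (hg t)).sub_const (g 0)).congr_deriv ?_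
    ring
  have hbd : ∀ t : ℝ, HasDerivAt (fun t : ℝ => K * ((1 - Real.exp (-(α * t))) / α))
      (Real.exp (-(α * t)) * K) t := by
    intro t
    have h2 : HasDerivAt (fun t : ℝ => -(α * t)) (-α) t := by
      simpa using! ((hasDerivAt_id t).const_mul α).neg
    refine (((h2.exp.const_sub 1).div_const α).const_mul K).congr_deriv ?_
    field_simp
  have hnexp : ∀ t : ℝ, ‖Complex.exp (-(μ * t))‖ = Real.exp (-(α * t)) := by
    intro t; rw [Complex.norm_exp]; simp [hα]
  have hK0 : 0 ≤ K := (norm_nonneg _).trans (hK 0)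
  have hmain : ∀ t : ℝ, 0 ≤ t → ‖g 0‖ ≤ K / α + Real.exp (-(α * t)) * B := by
    intro t ht
    have h := image_norm_le_of_norm_deriv_right_le_deriv_boundary (a := 0) (b := t)
      (fun s _ => (hderiv s).continuousAt.continuousWithinAt)
      (fun s _ => (hderiv s).hasDerivWithinAt) (by simp) hbd
      (fun s _ => by
        rw [norm_neg, norm_mul, hnexp]
        exact mul_le_mul_of_nonneg_left (hK s) (Real.exp_pos _).le) ⟨ht, le_rfl⟩
    have h1 : K * ((1 - Real.exp (-(α * t))) / α) ≤ K / α := by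
      rw [div_eq_mul_one_div K α]
      gcongr
      linarith [Real.exp_pos (-(α * t))]
    have h2 : ‖Complex.exp (-(μ * t)) * g t‖ ≤ Real.exp (-(α * t)) * B := by
      rw [norm_mul, hnexp]
      exact mul_le_mul_of_nonneg_left (hB t) (Real.exp_pos _).le
    have h3 := norm_sub_norm_le (g 0) (Complex.exp (-(μ * t)) * g t)
    rw [norm_sub_rev] at h3
    linarith
  have hlim : Tendsto (fun t : ℝ => K / α + Real.exp (-(α * t)) * B) atTop (𝓝 (K / α)) := by
    have h1 : Tendsto (fun t : ℝ => Real.exp (-(α * t))) atTop (𝓝 0) :=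
      Real.tendsto_exp_neg_atTop_nhds_zero.comp (tendsto_id.const_mul_atTop hμ)
    simpa using (h1.mul_const B).const_add (K / α)
  refine ge_of_tendsto hlim ?_
  filter_upwards [eventually_ge_atTop 0] with t ht using hmain t ht

/-- The resolvent bound in either half-plane; the left one is reduced to the right one by `t ↦ -t`. -/
theorem abs_re_mul_norm_le {g g' : ℝ → ℂ} {μ : ℂ} {B K : ℝ}
    (hg : ∀ t, HasDerivAt g (g' t) t) (hB : ∀ t, ‖g t‖ ≤ B) (hK : ∀ t, ‖μ * g t - g' t‖ ≤ K) :
    |μ.re| * ‖g 0‖ ≤ K := by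
  rcases lt_trichotomy μ.re 0 with h | h | h
  · have h1 := norm_le_div_of_re_pos (μ := -μ) (g := fun t => g (-t)) (g' := fun t => -g' (-t))
      (by simpa using h)
      (fun t => by simpa using! (hg (-t)).scomp t (hasDerivAt_neg t)) (fun t => hB (-t))
      (fun t => by
        have h2 := hK (-t)
        rw [← norm_neg] at h2
        rwa [show -μ * g (-t) - -g' (-t) = -(μ * g (-t) - g' (-t)) by ring])
    rw [abs_of_neg h]
    have h3 : 0 < (-μ).re := by simpa using h
    rw [le_div_iff₀ h3] at h1
    simpa [mul_comm] using h1
  · simpa [h] using (norm_nonneg _).trans (hK 0)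
  · have h1 := norm_le_div_of_re_pos h hg hB hK
    rw [le_div_iff₀ h] at h1
    rwa [abs_of_pos h, mul_comm]

open Polynomial in
/-- Cauchy's estimate for the coefficients of a polynomial, on the circle of radius `R⁻¹`. -/
theorem norm_coeff_le_of_norm_eval_le (q : ℂ[X]) {R K : ℝ} (hR : 0 < R)
    (hq : ∀ w : ℂ, ‖w‖ = R⁻¹ → ‖q.eval w‖ ≤ K) (m : ℕ) : ‖q.coeff m‖ ≤ K * R ^ m := by
  have hit : ∀ m : ℕ, iteratedDeriv m (fun w => q.eval w) =
      fun w => (derivative^[m] q).eval w := by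
    intro m
    induction m with
    | zero => simp
    | succ m ih =>
      rw [iteratedDeriv_succ, ih, Function.iterate_succ_apply']
      funext w
      exact Polynomial.deriv _
  have h := Complex.norm_iteratedDeriv_le_of_forall_mem_sphere_norm_le (c := 0) m
    (inv_pos.2 hR) q.differentiable.diffContOnCl (C := K) (fun w hw => hq w (by simpa using hw))
  have hc : iteratedDeriv m (fun w => q.eval w) 0 = (m.factorial : ℂ) * q.coeff m := by
    simp only [hit m]
    rw [← coeff_zero_eq_eval_zero, coeff_iterate_derivative]
    simp [Nat.descFactorial_self]
  rw [hc, norm_mul, Complex.norm_natCast, mul_div_assoc] at h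
  have h2 := le_of_mul_le_mul_left h (by positivity)
  simpa [div_eq_mul_inv] using h2

open Polynomial Finset in
/-- A bound `R ^ n` for one derivative `u n` controls all derivatives of order below `n`, with a
constant independent of `n`. The polynomial `p w = ∑ k < n, u k 0 * w ^ k` is, up to a factor `w⁻¹`,
a truncated resolvent at `w⁻¹`, so on the circle `‖w‖ = R⁻¹` it is bounded by
`R * (a 0 + 1) / |(w⁻¹).re|`. The factor `1 + R ^ 2 * w ^ 2` has absolute value
`2 * |(w⁻¹).re| / R` there and cancels the singularity; Cauchy's estimate for the product gives
the claim. -/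
theorem abs_add_le_of_chain {u : ℕ → ℝ → ℝ} {a : ℕ → ℝ} {R : ℝ} (hR : 0 < R)
    (hu : ∀ k t, HasDerivAt (u k) (u (k + 1) t) t) (hb : ∀ k t, |u k t| ≤ a k)
    {n : ℕ} (hn : a n ≤ R ^ n) {j : ℕ} (hj : j + 2 < n) :
    |u (j + 2) 0 + R ^ 2 * u j 0| ≤ 2 * (a 0 + 1) * R ^ (j + 2) := by
  set p : ℂ[X] := ∑ k ∈ range n, C (u k 0 : ℂ) * X ^ k with hp
  have hpc : ∀ k < n, p.coeff k = (u k 0 : ℂ) := by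
    intro k hk
    simp [hp, hk]
  have hbound : ∀ w : ℂ, ‖w‖ = R⁻¹ →
      ‖((1 + C ((R : ℂ) ^ 2) * X ^ 2) * p).eval w‖ ≤ 2 * (a 0 + 1) := by
    intro w hw
    have hw0 : w ≠ 0 := by
      rw [← norm_pos_iff, hw]; exact inv_pos.2 hR
    have hpe : p.eval w = ∑ k ∈ range n, (u k 0 : ℂ) * w ^ k := by
      simp [hp, eval_finsetSum]
    have hres := abs_re_mul_norm_le (μ := w⁻¹)
      (g := fun t => ∑ k ∈ range n, (u k t : ℂ) * w ^ k)
      (g' := fun t => ∑ k ∈ range n, (u (k + 1) t : ℂ) * w ^ k)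
      (B := ∑ k ∈ range n, a k * ‖w‖ ^ k) (K := R * (a 0 + 1))
      (fun t => HasDerivAt.fun_sum fun k _ => (hu k t).ofReal_comp.mul_const _)
      (fun t => by
        refine norm_sum_le_of_le _ fun k _ => ?_
        rw [norm_mul, norm_pow, Complex.norm_real]
        exact mul_le_mul_of_nonneg_right (hb k t) (by positivity))
      (fun t => by
        -- The sum telescopes to the boundary terms `u 0` and `u n`.
        have htel : ∀ m : ℕ, w⁻¹ * ∑ k ∈ range m, (u k t : ℂ) * w ^ k -
            ∑ k ∈ range m, (u (k + 1) t : ℂ) * w ^ k = w⁻¹ * (u 0 t - u m t * w ^ m) := by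
          intro m
          induction m with
          | zero => simp
          | succ m ih =>
            rw [sum_range_succ, sum_range_succ]
            have : (u (m + 1) t : ℂ) * w ^ m = w⁻¹ * (u (m + 1) t * w ^ (m + 1)) := by
              rw [pow_succ]; field_simp
            rw [this]
            linear_combination ih
        rw [htel n, norm_mul, norm_inv, hw, inv_inv]
        refine mul_le_mul_of_nonneg_left ((norm_sub_le _ _).trans ?_) hR.le
        rw [Complex.norm_real, norm_mul, Complex.norm_real, norm_pow, hw, inv_pow]
        refine add_le_add (hb 0 t) ?_
        rw [← div_eq_mul_inv, div_le_one (by positivity)]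
        exact (hb n t).trans hn)
    -- Since `R ^ 2 = |w⁻¹| ^ 2`, the factor equals `w * (w⁻¹ + conj w⁻¹)`.
    have hfac : ‖1 + (R : ℂ) ^ 2 * w ^ 2‖ = 2 * |(w⁻¹).re| / R := by
      have h1 : (R : ℂ) ^ 2 * (w * (starRingEnd ℂ) w) = 1 := by
        rw [Complex.mul_conj, Complex.normSq_eq_norm_sq, hw]
        have hR' : (R : ℂ) ≠ 0 := Complex.ofReal_ne_zero.2 hR.ne'
        push_cast
        field_simp
      have h2 : (starRingEnd ℂ) w⁻¹ = (R : ℂ) ^ 2 * w := by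
        rw [map_inv₀]
        have : (starRingEnd ℂ) w ≠ 0 := by simpa using hw0
        field_simp
        rw [← h1]; ring
      have h3 : 1 + (R : ℂ) ^ 2 * w ^ 2 = w * ((2 * (w⁻¹).re : ℝ) : ℂ) := by
        rw [← Complex.add_conj, h2]
        field_simp
      rw [h3, norm_mul, hw, Complex.norm_real, Real.norm_eq_abs, abs_mul, abs_two]
      field_simp
    have : ((1 + C ((R : ℂ) ^ 2) * X ^ 2) * p).eval w = (1 + (R : ℂ) ^ 2 * w ^ 2) * p.eval w := by
      simp
    rw [this, norm_mul, hfac, hpe]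
    have h5 : 2 * |(w⁻¹).re| / R * ‖∑ k ∈ range n, (u k 0 : ℂ) * w ^ k‖ =
        2 / R * (|(w⁻¹).re| * ‖∑ k ∈ range n, (u k 0 : ℂ) * w ^ k‖) := by ring
    rw [h5]
    refine (mul_le_mul_of_nonneg_left hres (by positivity)).trans (le_of_eq ?_)
    field_simp
  have h := norm_coeff_le_of_norm_eval_le _ hR hbound (j + 2)
  have hcoeff : ((1 + C ((R : ℂ) ^ 2) * X ^ 2) * p).coeff (j + 2) =
      ((u (j + 2) 0 + R ^ 2 * u j 0 : ℝ) : ℂ) := by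
    rw [add_mul, one_mul, coeff_add, mul_assoc, coeff_C_mul, coeff_X_pow_mul, hpc _ hj,
      hpc j (by omega)]
    push_cast
    ring
  rw [hcoeff, Complex.norm_real] at h
  exact h

/-! ### Root growth of sequences -/

theorem tendsto_const_rpow_one_div {c : ℝ} (hc : 0 < c) :
    Tendsto (fun k : ℕ => c ^ (1 / (k : ℝ))) atTop (𝓝 1) := by
  have h := (Real.continuousAt_const_rpow (a := c) (b := 0) hc.ne').tendsto.comp
    (tendsto_const_div_atTop_nhds_zero_nat (1 : ℝ))
  simpa [Function.comp_def] using h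

theorem rpow_one_div_le_iff {x r : ℝ} (hx : 0 ≤ x) (hr : 0 ≤ r) {k : ℕ} (hk : k ≠ 0) :
    x ^ (1 / (k : ℝ)) ≤ r ↔ x ≤ r ^ k := by
  have hk' : 0 < (k : ℝ) := by positivity
  rw [one_div, Real.rpow_inv_le_iff_of_pos hx hr hk', Real.rpow_natCast]

theorem rpow_one_div_le_mul_of_le_pow_mul {x y r : ℝ} (hx : 0 ≤ x) (hy : 0 ≤ y) (hr : 0 ≤ r)
    {k : ℕ} (hk : k ≠ 0) (h : x ≤ r ^ k * y) :
    x ^ (1 / (k : ℝ)) ≤ r * (y + 1) ^ (1 / (k : ℝ)) := by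
  have hpos : 0 < y + 1 := by linarith
  rw [rpow_one_div_le_iff hx (by positivity) hk, mul_pow, ← Real.rpow_natCast (_ ^ _) k,
    ← Real.rpow_mul hpos.le, one_div_mul_cancel (by positivity), Real.rpow_one]
  exact h.trans (mul_le_mul_of_nonneg_left (by linarith) (by positivity))

/-- An exponential bound for all large indices holds for all indices, with a larger constant. -/
theorem exists_forall_le_mul_pow {a : ℕ → ℝ} {ρ : ℝ} (hρ : 0 < ρ)
    (h : ∀ᶠ k in atTop, a k ≤ ρ ^ k) : ∃ C, ∀ k, a k ≤ C * ρ ^ k := by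
  obtain ⟨N, hN⟩ := eventually_atTop.1 h
  have hterm : ∀ k, 0 ≤ |a k| / ρ ^ k := fun k => by positivity
  refine ⟨1 + ∑ i ∈ Finset.range N, |a i| / ρ ^ i, fun k => ?_⟩
  have hsum : 0 ≤ ∑ i ∈ Finset.range N, |a i| / ρ ^ i := Finset.sum_nonneg fun i _ => hterm i
  rw [← div_le_iff₀ (pow_pos hρ k)]
  rcases lt_or_ge k N with hk | hk
  · have h1 := Finset.single_le_sum (fun i _ => hterm i) (Finset.mem_range.2 hk)
    have h2 : a k / ρ ^ k ≤ |a k| / ρ ^ k := by gcongr; exact le_abs_self _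
    linarith
  · have h1 := (div_le_one (pow_pos hρ k)).2 (hN k hk)
    linarith

/-- If exponential bounds for `a` self-improve to the constant `a 0`, as the hypothesis `hB` says, then the
limit of `a k ^ (1 / k)` is itself an admissible base. -/
theorem le_pow_mul_of_tendsto {a : ℕ → ℝ} (ha : ∀ k, 0 ≤ a k)
    (hB : ∀ ρ C : ℝ, 0 < ρ → (∀ k, a k ≤ C * ρ ^ k) → ∀ k, a k ≤ ρ ^ k * a 0) {d : ℝ}
    (hd : Tendsto (fun k : ℕ => a k ^ (1 / (k : ℝ))) atTop (𝓝 d)) (k : ℕ) :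
    a k ≤ d ^ k * a 0 := by
  have hd0 : 0 ≤ d := ge_of_tendsto' hd fun k => Real.rpow_nonneg (ha k) _
  have ht : Tendsto (fun ρ : ℝ => ρ ^ k * a 0) (𝓝[>] d) (𝓝 (d ^ k * a 0)) :=
    (((continuous_pow k).mul continuous_const).tendsto d).mono_left nhdsWithin_le_nhds
  refine ge_of_tendsto ht ?_
  filter_upwards [self_mem_nhdsWithin] with ρ hρ
  have hρ0 : 0 < ρ := hd0.trans_lt hρ
  obtain ⟨C, hC⟩ := exists_forall_le_mul_pow (a := a) hρ0 (by
    filter_upwards [hd.eventually_lt_const hρ, eventually_ne_atTop 0] with k hk hk0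
    exact (rpow_one_div_le_iff (ha k) hρ0.le hk0).1 hk.le)
  exact hB ρ C hρ0 hC k

theorem le_of_tendsto_of_le_pow_mul {a : ℕ → ℝ} (ha : ∀ k, 0 ≤ a k) {d σ : ℝ} (hσ : 0 ≤ σ)
    (hd : Tendsto (fun k : ℕ => a k ^ (1 / (k : ℝ))) atTop (𝓝 d))
    (hle : ∀ k, a k ≤ σ ^ k * a 0) : d ≤ σ := by
  -- `a 0 + 1` replaces `a 0`, whose roots do not tend to `1` when `a 0 = 0`.
  have h1 := (tendsto_const_rpow_one_div (c := a 0 + 1) (by linarith [ha 0])).const_mul σ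
  rw [mul_one] at h1
  refine le_of_tendsto_of_tendsto hd h1 ?_
  filter_upwards [eventually_ne_atTop 0] with k hk
  exact rpow_one_div_le_mul_of_le_pow_mul (ha k) (ha 0) hσ hk (hle k)

theorem le_mul_pow_of_two_step {a : ℕ → ℝ} {R K : ℝ} (hR : 0 < R) (hK : 0 ≤ K)
    (h : ∀ j, a (j + 2) ≤ R ^ 2 * a j + K * R ^ (j + 2)) :
    ∃ C, 0 ≤ C ∧ ∀ j, a j ≤ C * (j + 1) * R ^ j := by
  -- `C` dominates the increment `K` and the first two values of `a j / R ^ j`.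
  set C : ℝ := max K (max (a 0) (a 1 / R)) with hC
  have hKC : K ≤ C := le_max_left _ _
  have h0 : a 0 ≤ C := (le_max_left _ _).trans (le_max_right _ _)
  have h1 : a 1 / R ≤ C := (le_max_right _ _).trans (le_max_right _ _)
  have hC0 : 0 ≤ C := hK.trans hKC
  refine ⟨C, hC0, fun j => ?_⟩
  have key : ∀ j, a j ≤ C * (j + 1) * R ^ j ∧ a (j + 1) ≤ C * ((j + 1 : ℕ) + 1) * R ^ (j + 1) := by
    intro j
    induction j with
    | zero =>
      refine ⟨by simpa using h0, ?_⟩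
      rw [div_le_iff₀ hR] at h1
      push_cast
      nlinarith [mul_nonneg hC0 hR.le]
    | succ j ih =>
      refine ⟨ih.2, (h j).trans ?_⟩
      have h2 := mul_le_mul_of_nonneg_left ih.1 (sq_nonneg R)
      have h3 := mul_le_mul_of_nonneg_right hKC (pow_pos hR (j + 2)).le
      have h4 : 0 ≤ C * R ^ (j + 2) := by positivity
      push_cast
      calc _ ≤ R ^ 2 * (C * (j + 1) * R ^ j) + C * R ^ (j + 2) := add_le_add h2 h3
        _ = C * (j + 2) * R ^ (j + 2) := by ring
        _ ≤ _ := by rw [show j + 1 + 1 = j + 2 by rfl]; nlinarith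
  exact (key j).1

/-- The limit is the infimum `s` of the exponential bases admissible for `a`. By `hB` the roots
`a k ^ (1 / k)` do not exceed `s` asymptotically. If `a n ≤ R ^ n` for infinitely many `n` with some
`R < s`, then by `hI` the sequence `a j` is `O(j * R ^ j)`, so that a base below `s` is admissible. -/
theorem exists_tendsto_rpow_one_div {a : ℕ → ℝ} (ha : ∀ k, 0 ≤ a k)
    (hB : ∀ ρ C : ℝ, 0 < ρ → (∀ k, a k ≤ C * ρ ^ k) → ∀ k, a k ≤ ρ ^ k * a 0)
    (hI : ∀ R : ℝ, 0 < R → (∃ᶠ n in atTop, a n ≤ R ^ n) →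
      ∀ j, a (j + 2) ≤ R ^ 2 * a j + 2 * (a 0 + 1) * R ^ (j + 2))
    {σ C : ℝ} (hσ : 0 < σ) (hle : ∀ k, a k ≤ C * σ ^ k) :
    ∃ d, Tendsto (fun k : ℕ => a k ^ (1 / (k : ℝ))) atTop (𝓝 d) := by
  set S : Set ℝ := {ρ | 0 < ρ ∧ ∃ C, ∀ k, a k ≤ C * ρ ^ k} with hS
  have hSne : S.Nonempty := ⟨σ, hσ, C, hle⟩
  have hSbdd : BddBelow S := ⟨0, fun ρ hρ => hρ.1.le⟩
  refine ⟨sInf S, tendsto_order.2 ⟨fun r hr => ?_, fun r hr => ?_⟩⟩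
  · rcases lt_or_ge r 0 with h0 | h0
    · exact Eventually.of_forall fun k => h0.trans_le (Real.rpow_nonneg (ha k) _)
    obtain ⟨R, hrR, hRs⟩ := exists_between hr
    have hR : 0 < R := h0.trans_lt hrR
    have hev : ∀ᶠ n in atTop, R ^ n < a n := by
      by_contra hnot
      have hfreq : ∃ᶠ n in atTop, a n ≤ R ^ n := by
        simpa [Filter.Frequently, not_le] using hnot
      obtain ⟨C', hC', hle'⟩ := le_mul_pow_of_two_step hR (by linarith [ha 0]) (hI R hR hfreq)
      obtain ⟨R', hRR', hR's⟩ := exists_between hRs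
      have hR' : 0 < R' := hR.trans hRR'
      have hmem : R' ∈ S := by
        refine ⟨hR', ?_⟩
        refine exists_forall_le_mul_pow hR' ?_
        have hq : Tendsto (fun j : ℕ => C' * ((j : ℝ) * (R / R') ^ j + (R / R') ^ j)) atTop
            (𝓝 0) := by
          have hq1 : R / R' < 1 := (div_lt_one hR').2 hRR'
          have hq0 : 0 ≤ R / R' := by positivity
          simpa using ((tendsto_self_mul_const_pow_of_lt_one hq0 hq1).add
            (tendsto_pow_atTop_nhds_zero_of_lt_one hq0 hq1)).const_mul C'
        filter_upwards [hq.eventually_lt_const one_pos] with j hj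
        refine (hle' j).trans ?_
        have h2 : C' * (j + 1) * R ^ j =
            (C' * ((j : ℝ) * (R / R') ^ j + (R / R') ^ j)) * R' ^ j := by
          rw [div_pow]; field_simp
        rw [h2]
        exact mul_le_of_le_one_left (by positivity) hj.le
      exact absurd (csInf_le hSbdd hmem) (not_le.2 hR's)
    filter_upwards [hev, eventually_ne_atTop 0] with n hn hn0
    refine hrR.trans_le ?_
    by_contra hlt
    exact absurd ((rpow_one_div_le_iff (ha n) hR.le hn0).1 (not_le.1 hlt).le) (not_le.2 hn)
  · obtain ⟨ρ, ⟨hρ, C', hC'⟩, hρr⟩ := (csInf_lt_iff hSbdd hSne).1 hr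
    have h1 := (tendsto_const_rpow_one_div (c := a 0 + 1) (by linarith [ha 0])).const_mul ρ
    rw [mul_one] at h1
    filter_upwards [h1.eventually_lt_const hρr, eventually_ne_atTop 0] with k hk hk0
    exact (rpow_one_div_le_mul_of_le_pow_mul (ha k) (ha 0) hρ.le hk0
      (hB ρ C' hρ hC' k)).trans_lt hk

/-! ### Orbits of the isometry group -/

namespace BernsteinVectors

variable {𝕜 E : Type*} [RCLike 𝕜] [NormedAddCommGroup E] [NormedSpace 𝕜 E]

theorem tendsto_quotient_powerApply (U : IsometryGroup 𝕜 E) (f : smoothVectors U.generator)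
    (k : ℕ) : Tendsto (fun t : ℝ => U.quotient t (powerApply U.generator k f)) (𝓝[≠] 0)
      (𝓝 (powerApply U.generator (k + 1) f)) := by
  obtain ⟨h, hA⟩ := (mem_compose_domain _ _ _).1 (mem_power_domain U.generator f.2 (k + 1))
  exact U.tendsto_generator ⟨power U.generator k ⟨f, h⟩, hA⟩

/-- The real function `t ↦ Re g (U t f)`, the orbit of `f` seen by the functional `g`. Taking real
parts treats real and complex scalars alike. -/
def orbitFunction (U : IsometryGroup 𝕜 E) (g : StrongDual 𝕜 E) (f : E) (t : ℝ) : ℝ :=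
  RCLike.re (g (U.toFun t f))

theorem abs_orbitFunction_le (U : IsometryGroup 𝕜 E) {g : StrongDual 𝕜 E} (hg : ‖g‖ ≤ 1) (f : E)
    (t : ℝ) : |orbitFunction U g f t| ≤ ‖f‖ :=
  (RCLike.abs_re_le_norm _).trans <| (g.le_of_opNorm_le hg _).trans_eq <| by simp

theorem hasDerivAt_orbitFunction (U : IsometryGroup 𝕜 E) (g : StrongDual 𝕜 E) {f f' : E}
    (hf : Tendsto (fun t : ℝ => U.quotient t f) (𝓝[≠] 0) (𝓝 f')) (t : ℝ) :
    HasDerivAt (orbitFunction U g f) (orbitFunction U g f' t) t := by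
  rw [hasDerivAt_iff_tendsto_slope_zero]
  have hc : Continuous fun x : E => RCLike.re (g (U.toFun t x)) :=
    RCLike.continuous_re.comp (g.continuous.comp (U.toFun t).continuous)
  refine ((hc.tendsto f').comp hf).congr fun s => ?_
  simp only [Function.comp_apply, orbitFunction, IsometryGroup.quotient_apply, map_smul, map_sub,
    U.map_add', smul_eq_mul]
  rw [← RCLike.ofReal_inv, RCLike.re_ofReal_mul, map_sub]

/-- The orbits of the vectors `D ^ k f`, seen by a functional that norms `D ^ m f`, form a sequence of
real functions each of which is the derivative of the one before. -/
theorem exists_norming_chain (U : IsometryGroup 𝕜 E) (f : smoothVectors U.generator) (m : ℕ) :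
    ∃ u : ℕ → ℝ → ℝ, (∀ k t, HasDerivAt (u k) (u (k + 1) t) t) ∧
      (∀ k t, |u k t| ≤ ‖powerApply U.generator k f‖) ∧
      u m 0 = ‖powerApply U.generator m f‖ := by
  obtain ⟨g, hg, hgx⟩ := exists_dual_vector'' 𝕜 (powerApply U.generator m f)
  refine ⟨fun k => orbitFunction U g (powerApply U.generator k f),
    fun k t => hasDerivAt_orbitFunction U g (tendsto_quotient_powerApply U f k) t,
    fun k t => abs_orbitFunction_le U hg _ t, ?_⟩
  simp [orbitFunction, U.map_zero', hgx]

/-- Bernstein's inequality for vectors: the constant in an exponential bound for `‖D ^ k f‖` may be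
taken to be `‖f‖`. -/
theorem norm_powerApply_le_of_exponential_bound (U : IsometryGroup 𝕜 E)
    (f : smoothVectors U.generator) {ρ C : ℝ} (hρ : 0 < ρ)
    (h : ∀ k, ‖powerApply U.generator k f‖ ≤ C * ρ ^ k) (k : ℕ) :
    ‖powerApply U.generator k f‖ ≤ ρ ^ k * ‖powerApply U.generator 0 f‖ := by
  induction k with
  | zero => simp
  | succ k ih =>
    obtain ⟨u, hu, hb, hn⟩ := exists_norming_chain U f (k + 1)
    have h1 := deriv_le_of_chain (u := fun j => u (j + k)) (C := C * ρ ^ k) hρ.le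
      (fun j t => by simpa [add_right_comm] using hu (j + k) t)
      (fun j t => ((hb (j + k) t).trans (h (j + k))).trans_eq (by ring))
      (M := ‖powerApply U.generator k f‖) (fun t => by simpa using hb k t)
    rw [add_comm 1 k, hn] at h1
    refine h1.trans ((mul_le_mul_of_nonneg_left ih hρ.le).trans_eq ?_)
    ring

/-- Smallness of `‖D ^ n f‖` for infinitely many `n` bounds `‖D ^ j f‖` for every `j`. -/
theorem norm_powerApply_add_two_le (U : IsometryGroup 𝕜 E) (f : smoothVectors U.generator)
    {R : ℝ} (hR : 0 < R) (h : ∃ᶠ n in atTop, ‖powerApply U.generator n f‖ ≤ R ^ n) (j : ℕ) :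
    ‖powerApply U.generator (j + 2) f‖ ≤ R ^ 2 * ‖powerApply U.generator j f‖ +
      2 * (‖powerApply U.generator 0 f‖ + 1) * R ^ (j + 2) := by
  obtain ⟨n, hn, hjn⟩ := (h.and_eventually (eventually_gt_atTop (j + 2))).exists
  obtain ⟨u, hu, hb, hnorm⟩ := exists_norming_chain U f (j + 2)
  have h1 := (le_abs_self _).trans (abs_add_le_of_chain hR hu hb hn hjn)
  have h2 := mul_le_mul_of_nonneg_left ((neg_le_abs _).trans (hb j 0)) (sq_nonneg R)
  rw [hnorm] at h1
  linarith

/-- If the roots `‖D ^ k f‖ ^ (1 / k)` converge, then their limit is the least admissible `σ`. -/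
theorem spectralBound_eq_of_tendsto (U : IsometryGroup 𝕜 E) (f : smoothVectors U.generator)
    {d : ℝ} (hd : Tendsto (fun k : ℕ => ‖powerApply U.generator k f‖ ^ (1 / (k : ℝ))) atTop
      (𝓝 d)) :
    (f : E) ∈ bernsteinSpace U.generator d ∧ (d : EReal) = spectralBound U.generator (f : E) := by
  have ha : ∀ k, 0 ≤ ‖powerApply U.generator k f‖ := fun k => norm_nonneg _
  have hd0 : 0 ≤ d := ge_of_tendsto' hd fun k => Real.rpow_nonneg (ha k) _
  have hmem : (f : E) ∈ bernsteinSpace U.generator d := ⟨f.2, le_pow_mul_of_tendsto ha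
    (fun ρ C hρ h => norm_powerApply_le_of_exponential_bound U f hρ h) hd⟩
  refine ⟨hmem, ((spectralBound_eq_coe_iff _ _ _).2 ⟨⟨hd0, hmem⟩, ?_⟩).symm⟩
  rintro σ ⟨hσ, _, hle⟩
  exact le_of_tendsto_of_le_pow_mul ha hσ hd hle

end BernsteinVectors

theorem mainTheorem1 {𝕜 E : Type*} [RCLike 𝕜] [NormedAddCommGroup E] [NormedSpace 𝕜 E]
    [CompleteSpace E] (U : BernsteinVectors.IsometryGroup 𝕜 E) (D : E →ₗ.[𝕜] E)
    (hD : D = U.generator) (f : E) :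
    (∀ σ : ℝ, 0 < σ → f ∈ BernsteinVectors.bernsteinSpace D σ →
      ∃ (hf : f ∈ BernsteinVectors.smoothVectors D) (d : ℝ),
        Tendsto (fun k : ℕ => ‖BernsteinVectors.powerApply D k ⟨f, hf⟩‖ ^ (1 / (k : ℝ)))
          atTop (𝓝 d) ∧
        (d : EReal) = BernsteinVectors.spectralBound D f) ∧
    (∀ (hf : f ∈ BernsteinVectors.smoothVectors D) (d : ℝ),
      Tendsto (fun k : ℕ => ‖BernsteinVectors.powerApply D k ⟨f, hf⟩‖ ^ (1 / (k : ℝ)))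
          atTop (𝓝 d) →
        f ∈ BernsteinVectors.bernsteinSpace D d ∧
        (d : EReal) = BernsteinVectors.spectralBound D f) := by
  subst hD
  refine ⟨fun σ hσ hfσ => ?_, fun hf d hd =>
    BernsteinVectors.spectralBound_eq_of_tendsto U ⟨f, hf⟩ hd⟩
  obtain ⟨hf, hle⟩ := hfσ
  obtain ⟨d, hd⟩ := exists_tendsto_rpow_one_div (fun k => norm_nonneg _)
    (fun ρ C hρ h => BernsteinVectors.norm_powerApply_le_of_exponential_bound U ⟨f, hf⟩ hρ h)
    (fun R hR h => BernsteinVectors.norm_powerApply_add_two_le U ⟨f, hf⟩ hR h) hσ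
    (C := ‖f‖) (fun k => (hle k).trans_eq (mul_comm _ _))
  exact ⟨hf, d, hd, (BernsteinVectors.spectralBound_eq_of_tendsto U ⟨f, hf⟩ hd).2⟩
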